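/- Let $V=T^*\mathbb C^n=\mathbb C^{2n}$ with canonical coordinates $(z^1,\dots,z^n,w_1,\dots,w_n)$, put $x^i=\operatorname{Re} z^i$, $y_j=\operatorname{Re} w_j$, and let $V^\tau=T^*\mathbb R^n=\mathbb R^{2n}\subset V$ be the fixed point set of complex conjugation $\tau$. Let $(M,J)$ be a complex manifold of complex dimension $n$ and let $\phi:M\to V$ be a holomorphic immersion that is totally complex, i.e. $V^\tau\cap d\phi(T_pM)=0$ for all $p\in M$. Let $\nabla$ be the induced connection on the real tangent bundle of $M$, given by $$\nabla_XY=(d\operatorname{Re}\phi)^{-1}\bigl(X\bigl(d\operatorname{Re}\phi\,(Y)\bigr)\bigr),\qquad \operatorname{Re}\phi:M\to V^\tau=\mathbb R^{2n}$$ (equivalently, the connection for which the coordinate vector fields of the local coordinates $x^i\circ\phi,\,y_j\circ\phi$ are parallel), and let $\omega=2\phi^*\bigl(\sum_{i=1}^n dx^i\wedge dy_i\bigr)$. Then $\nabla$ is a well-defined connection and the following hold. (i) $(M,J,\nabla,\omega)$ is a special symplectic manifold: $\nabla$ is a smooth flat torsion-free connection with $d^\nabla J=0$, i.e. $(\nabla_XJ)Y=(\nabla_YJ)X$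 for all vector fields $X,Y$, and $\omega$ is a symplectic form (smooth, closed, nondegenerate) with $\nabla\omega=0$. (ii) The functions $(x^1\circ\phi,\dots,x^n\circ\phi,y_1\circ\phi,\dots,y_n\circ\phi)$ define a real special coordinate system around each point $p$ of $M$: on some open neighbourhood of $p$ they form a smooth local coordinate system $(\xi^1,\dots,\xi^n,\eta_1,\dots,\eta_n)$ consisting of $\nabla$-affine functions ($\nabla d\xi^i=0$, $\nabla d\eta_j=0$) with $\omega=2\sum_{i=1}^n d\xi^i\wedge d\eta_i$. -/

import Mathlib

open scoped Manifold ContDiff Topology Bundle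

noncomputable section

namespace SpecialGeometry

/-! ### Complex manifolds as real manifolds

A complex manifold is a manifold `M` modelled on a finite-dimensional complex vector space `E` with
holomorphic transition functions, i.e. `IsManifold 𝓘(ℂ, E) ω M`. The same charts make `M` a real
manifold; its real tangent bundle is `TangentSpace 𝓘(ℝ, E)`. -/

section Basic

variable {E : Type*} [NormedAddCommGroup E] [NormedSpace ℂ E]
  {M : Type*} [TopologicalSpace M] [ChartedSpace E M]

/-- The real-analytic (in particular smooth) manifold underlying a complex manifold. -/
instance instIsManifoldReal [IsManifold 𝓘(ℂ, E) ω M] : IsManifold 𝓘(ℝ, E) ω M := by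
  refine isManifold_of_contDiffOn 𝓘(ℝ, E) ω M fun e e' he he' => ?_
  have h := (contDiffGroupoid ω 𝓘(ℂ, E)).compatible (M := M) he he'
  have h1 := (mem_groupoid_of_pregroupoid.1 h).1
  exact ContDiffOn.restrict_scalars (𝕜' := ℂ) ℝ h1

/-- The complex structure `J` of a complex manifold, as an endomorphism field of the real tangent
bundle: multiplication by `i` on each tangent space. -/
def complexStructure (p : M) :
    TangentSpace 𝓘(ℝ, E) p →L[ℝ] TangentSpace 𝓘(ℝ, E) p :=
  (Complex.I • ContinuousLinearMap.id ℝ E : E →L[ℝ] E)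

variable (E M) in
/-- Real vector fields (not necessarily continuous). -/
abbrev VField := (p : M) → TangentSpace 𝓘(ℝ, E) p

variable (E M) in
/-- Fields of real bilinear forms on the real tangent bundle (not necessarily continuous). -/
abbrev BilinField :=
  (p : M) → TangentSpace 𝓘(ℝ, E) p →L[ℝ] TangentSpace 𝓘(ℝ, E) p →L[ℝ] ℝ

/-- `α ∧ β` for two covectors: `(u, v) ↦ α u * β v - β u * α v`. -/
def wedge {T : Type*} [AddCommGroup T] [Module ℝ T] [TopologicalSpace T]
    [IsTopologicalAddGroup T] [ContinuousSMul ℝ T] (α β : T →L[ℝ] ℝ) : T →L[ℝ] T →L[ℝ] ℝ :=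
  α.smulRight β - β.smulRight α

end Basic

/-! ### Special complex and special symplectic manifolds -/

section Special

variable {E : Type*} [NormedAddCommGroup E] [NormedSpace ℂ E] [FiniteDimensional ℂ E]
  {M : Type*} [TopologicalSpace M] [ChartedSpace E M] [IsManifold 𝓘(ℂ, E) ω M]

variable (E M) in
/-- Linear connections on the real tangent bundle, as operators on vector fields:
`∇ Y p (X p)` is the value at `p` of `∇_X Y`. -/
abbrev Connection := CovariantDerivative 𝓘(ℝ, E) E (TangentSpace 𝓘(ℝ, E) : M → Type _)

/-- `X` is a smooth vector field near `p`. -/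
def SmoothAt (X : VField E M) (p : M) : Prop :=
  ContMDiffAt 𝓘(ℝ, E) 𝓘(ℝ, E).tangent ∞
    (fun q => (⟨q, X q⟩ : TangentBundle 𝓘(ℝ, E) M)) p

/-- The vector field `∇_X Y`. -/
def Connection.cov (D : Connection E M) (X Y : VField E M) : VField E M :=
  fun q => D Y q (X q)

/-- `∇` has zero curvature: `∇_X ∇_Y Z - ∇_Y ∇_X Z - ∇_{[X, Y]} Z = 0`. -/
def IsFlat (D : Connection E M) : Prop :=
  ∀ (p : M) (X Y Z : VField E M), SmoothAt X p → SmoothAt Y p → SmoothAt Z p →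
    Connection.cov D X (Connection.cov D Y Z) p - Connection.cov D Y (Connection.cov D X Z) p
      - Connection.cov D (VectorField.mlieBracket 𝓘(ℝ, E) X Y) Z p = 0

/-- `∇` has zero torsion tensor. -/
def IsTorsionFree (D : Connection E M) : Prop :=
  haveI : CompleteSpace E := FiniteDimensional.complete ℂ E
  CovariantDerivative.torsion D = 0

/-- The vector field `(∇_X A) Y = ∇_X (A Y) - A (∇_X Y)`, for an endomorphism field `A`. -/
def covEnd (D : Connection E M)
    (A : (p : M) → TangentSpace 𝓘(ℝ, E) p →L[ℝ] TangentSpace 𝓘(ℝ, E) p)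
    (X Y : VField E M) : VField E M :=
  fun p => Connection.cov D X (fun q => A q (Y q)) p - A p (Connection.cov D X Y p)

/-- A special complex manifold: a complex manifold with a (smooth) flat torsion-free connection on
its real tangent bundle such that `(d^∇ J)(X, Y) = (∇_X J) Y - (∇_Y J) X` vanishes. -/
structure IsSpecialComplex (D : Connection E M) : Prop where
  smooth : CovariantDerivative.ContMDiffCovariantDerivative D ∞
  flat : IsFlat D
  torsionFree : IsTorsionFree D
  dJ_eq_zero : ∀ (p : M) (X Y : VField E M), SmoothAt X p → SmoothAt Y p →
    covEnd D complexStructure X Y p - covEnd D complexStructure Y X p = 0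

/-- The derivative at `p` of the function `f` in the direction of the vector field `X`. -/
def lieDeriv (X : VField E M) (f : M → ℝ) (p : M) : ℝ := mvfderiv 𝓘(ℝ, E) f p (X p)

/-- `B` is a symplectic form: a smooth, alternating, nondegenerate, closed 2-form. -/
structure IsSymplecticForm (B : BilinField E M) : Prop where
  smooth : ContMDiff 𝓘(ℝ, E) (𝓘(ℝ, E).prod 𝓘(ℝ, E →L[ℝ] E →L[ℝ] ℝ)) ∞
    (fun p => Bundle.TotalSpace.mk' (E →L[ℝ] E →L[ℝ] ℝ)
      (E := fun p : M => TangentSpace 𝓘(ℝ, E) p →L[ℝ] TangentSpace 𝓘(ℝ, E) p →L[ℝ] ℝ) p (B p))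
  alternating : ∀ (p : M) (u : TangentSpace 𝓘(ℝ, E) p), B p u u = 0
  nondegenerate : ∀ (p : M) (u : TangentSpace 𝓘(ℝ, E) p), (∀ v, B p u v = 0) → u = 0
  /-- `dB(X, Y, Z) = 0`, with the invariant formula for the exterior derivative. -/
  closed : ∀ (p : M) (X Y Z : VField E M), SmoothAt X p → SmoothAt Y p → SmoothAt Z p →
    lieDeriv X (fun q => B q (Y q) (Z q)) p - lieDeriv Y (fun q => B q (X q) (Z q)) p
      + lieDeriv Z (fun q => B q (X q) (Y q)) p
      - B p (VectorField.mlieBracket 𝓘(ℝ, E) X Y p) (Z p)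
      + B p (VectorField.mlieBracket 𝓘(ℝ, E) X Z p) (Y p)
      - B p (VectorField.mlieBracket 𝓘(ℝ, E) Y Z p) (X p) = 0

/-- `∇ B = 0`. -/
def IsParallel (D : Connection E M) (B : BilinField E M) : Prop :=
  ∀ (p : M) (X Y Z : VField E M), SmoothAt X p → SmoothAt Y p → SmoothAt Z p →
    lieDeriv X (fun q => B q (Y q) (Z q)) p
      = B p (Connection.cov D X Y p) (Z p) + B p (Y p) (Connection.cov D X Z p)

/-- A special symplectic manifold: a special complex manifold with a parallel symplectic form. -/
structure IsSpecialSymplectic (D : Connection E M) (B : BilinField E M) : Prop where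
  specialComplex : IsSpecialComplex D
  symplectic : IsSymplecticForm B
  parallel : IsParallel D B

/-- The function `f` is `∇`-affine on the open set `U`: it is smooth there and `∇ df = 0`, i.e.
`X (df Y) = df (∇_X Y)`. -/
def IsAffineOn (D : Connection E M) (f : M → ℝ) (U : Set M) : Prop :=
  ContMDiffOn 𝓘(ℝ, E) 𝓘(ℝ, ℝ) ∞ f U ∧
  ∀ p ∈ U, ∀ X Y : VField E M, SmoothAt X p → SmoothAt Y p →
    lieDeriv X (lieDeriv Y f) p = mvfderiv 𝓘(ℝ, E) f p (Connection.cov D X Y p)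

/-- Local real coordinate systems `(x¹, …, xⁿ, y₁, …, yₙ)` on `M`: diffeomorphisms from an open
subset of `M` onto an open subset of `ℝⁿ × ℝⁿ`. -/
abbrev LocalCoordinates (E : Type*) [NormedAddCommGroup E] [NormedSpace ℂ E]
    (M : Type*) [TopologicalSpace M] [ChartedSpace E M] (n : ℕ) :=
  PartialDiffeomorph 𝓘(ℝ, E) 𝓘(ℝ, (Fin n → ℝ) × (Fin n → ℝ)) M ((Fin n → ℝ) × (Fin n → ℝ)) ∞

/-- A local coordinate system `(x, y)` is a real special coordinate system if the coordinate
functions are `∇`-affine and `B = 2 ∑ dxⁱ ∧ dyᵢ` on the coordinate domain. -/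
structure IsRealSpecialCoordinates {n : ℕ} (D : Connection E M) (B : BilinField E M)
    (e : LocalCoordinates E M n) : Prop where
  affine_x : ∀ i, IsAffineOn D (fun q => (e q).1 i) e.source
  affine_y : ∀ i, IsAffineOn D (fun q => (e q).2 i) e.source
  form_eq : ∀ p ∈ e.source, B p = (2 : ℝ) • ∑ i : Fin n,
    wedge (mvfderiv 𝓘(ℝ, E) (fun q => (e q).1 i) p) (mvfderiv 𝓘(ℝ, E) (fun q => (e q).2 i) p)

end Special

/-! ### The ambient space `V = T^* ℂⁿ` -/

/-- `V = T^* ℂⁿ = ℂ²ⁿ`; a point is `(z, w)` with `z = (z¹, …, zⁿ)` and `w = (w₁, …, wₙ)`. -/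
abbrev CotangentCn (n : ℕ) := (Fin n → ℂ) × (Fin n → ℂ)

/-- `V^τ = T^* ℝⁿ`, the fixed point set of complex conjugation `τ` on `V`. -/
def realForm (n : ℕ) : Submodule ℝ (CotangentCn n) where
  carrier := {v | star v = v}
  add_mem' {a b} ha hb := by
    simp only [Set.mem_ofPred_eq] at ha hb ⊢
    rw [star_add, ha, hb]
  zero_mem' := star_zero _
  smul_mem' c v hv := by
    simp only [Set.mem_ofPred_eq] at hv ⊢
    rw [star_smul, hv, star_trivial]

/-- The real covector `dxⁱ` on `V`, `xⁱ = Re zⁱ`. -/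
def dx {n : ℕ} (i : Fin n) : CotangentCn n →L[ℝ] ℝ :=
  Complex.reCLM ∘L ContinuousLinearMap.proj (R := ℝ) i ∘L
    ContinuousLinearMap.fst ℝ (Fin n → ℂ) (Fin n → ℂ)

/-- The real covector `dyᵢ` on `V`, `yᵢ = Re wᵢ`. -/
def dy {n : ℕ} (i : Fin n) : CotangentCn n →L[ℝ] ℝ :=
  Complex.reCLM ∘L ContinuousLinearMap.proj (R := ℝ) i ∘L
    ContinuousLinearMap.snd ℝ (Fin n → ℂ) (Fin n → ℂ)

section Immersion

variable {E : Type*} [NormedAddCommGroup E] [NormedSpace ℂ E]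
  {M : Type*} [TopologicalSpace M] [ChartedSpace E M] {n : ℕ}

/-- `φ : M → V` is a holomorphic immersion. -/
structure IsHolomorphicImmersion (φ : M → CotangentCn n) : Prop where
  holomorphic : ContMDiff 𝓘(ℂ, E) 𝓘(ℂ, CotangentCn n) ω φ
  injective_deriv : ∀ p, Function.Injective (mvfderiv 𝓘(ℂ, E) φ p)

/-- `φ` is totally complex: `V^τ ∩ dφ(T_p M) = 0` for all `p`. -/
def IsTotallyComplex (φ : M → CotangentCn n) : Prop :=
  ∀ p : M, (realForm n : Set (CotangentCn n)) ∩ Set.range (mvfderiv 𝓘(ℂ, E) φ p) = {0}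

/-- `Re φ`, in the coordinates `(x, y) = (Re z, Re w)` of `V^τ = T^* ℝⁿ = ℝⁿ × ℝⁿ`. -/
def realPart (φ : M → CotangentCn n) (p : M) : (Fin n → ℝ) × (Fin n → ℝ) :=
  (fun i => ((φ p).1 i).re, fun i => ((φ p).2 i).re)

/-- The connection induced by `φ`: the one for which the frames of coordinate vector fields of the
local coordinates `Re φ = (x, y)` on `M` are parallel. The coordinate components of a
vector field `Y` are the entries of `d(Re φ)(Y)`, and `∇ Y` is computed by differentiating these
components:  `∇_X Y = (d(Re φ))⁻¹ (X (d(Re φ)(Y)))`. -/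
def inducedConnection (φ : M → CotangentCn n) (Y : VField E M) (p : M) :
    TangentSpace 𝓘(ℝ, E) p →L[ℝ] TangentSpace 𝓘(ℝ, E) p :=
  (mvfderiv 𝓘(ℝ, E) (realPart φ) p).inverse ∘L
    mvfderiv 𝓘(ℝ, E) (fun q => mvfderiv 𝓘(ℝ, E) (realPart φ) q (Y q)) p

/-- The form `2 φ^*(∑ dxⁱ ∧ dyᵢ)`. -/
def inducedForm (φ : M → CotangentCn n) : BilinField E M := fun p =>
  (2 : ℝ) • ∑ i : Fin n,
    wedge (dx i ∘L mvfderiv 𝓘(ℝ, E) φ p) (dy i ∘L mvfderiv 𝓘(ℝ, E) φ p)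

end Immersion

end SpecialGeometry

end

open scoped Manifold ContDiff Topology Bundle

namespace SpecialGeometry

/-! ### Derivatives along vector fields on a real manifold. -/

section Calculus

variable {E : Type*} [NormedAddCommGroup E] [NormedSpace ℝ E]
  {M : Type*} [TopologicalSpace M] [ChartedSpace E M]
  {W W₁ W₂ W' : Type*} [NormedAddCommGroup W] [NormedSpace ℝ W]
  [NormedAddCommGroup W₁] [NormedSpace ℝ W₁] [NormedAddCommGroup W₂] [NormedSpace ℝ W₂]
  [NormedAddCommGroup W'] [NormedSpace ℝ W']

/-! Put `f = Re φ`. If `df(u) = 0`, then `dφ(u)` is purely imaginary, so `i dφ(u) = dφ(Ju)` lies in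
`V^τ` and vanishes by total complexity; as `φ` is an immersion, `u = 0`. Both sides have real
dimension `2n`, so `df` is invertible (`isInvertible_mvfderiv_realPart`), and the connection and the
form are pulled back from the trivial connection and a constant form on `ℝ²ⁿ`.

Since `df` is injective, identities may be checked after applying it, where `df(∇_X Y) = X(df Y)`.
They then come from `dh[X,Y] = X(dh Y) - Y(dh X)` (`mvfderiv_mlieBracket`): `h = f` gives zero
torsion, `h = df(Z)` flatness, and `h = Re(iφ)`, for which `dh = df ∘ J`, gives `d^∇ J = 0`. The
form is parallel by the product rule, and closed because it is parallel and the torsion vanishes.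
The coordinates come from the inverse function theorem. -/

theorem hasMFDerivAt_mvfderiv {f : M → W} {p : M} (hf : MDifferentiableAt 𝓘(ℝ, E) 𝓘(ℝ, W) f p) :
    HasMFDerivAt 𝓘(ℝ, E) 𝓘(ℝ, W) f p (mvfderiv 𝓘(ℝ, E) f p) :=
  hf.hasMFDerivAt

theorem mvfderiv_congr_of_eventuallyEq {f g : M → W} {p : M} (h : f =ᶠ[𝓝 p] g) :
    mvfderiv 𝓘(ℝ, E) f p = mvfderiv 𝓘(ℝ, E) g p := by
  ext v
  exact DFunLike.congr_fun (h.mfderiv_eq (I := 𝓘(ℝ, E)) (I' := 𝓘(ℝ, W))) v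

theorem mvfderiv_clm_comp (L : W →L[ℝ] W') {f : M → W} {p : M}
    (hf : MDifferentiableAt 𝓘(ℝ, E) 𝓘(ℝ, W) f p) :
    mvfderiv 𝓘(ℝ, E) (fun q => L (f q)) p = L ∘L mvfderiv 𝓘(ℝ, E) f p :=
  ((L.hasMFDerivAt (x := f p)).comp p (hasMFDerivAt_mvfderiv hf)).mfderiv

theorem mvfderiv_bilin (B : W₁ →L[ℝ] W₂ →L[ℝ] W) {f : M → W₁} {g : M → W₂} {p : M}
    (hf : MDifferentiableAt 𝓘(ℝ, E) 𝓘(ℝ, W₁) f p) (hg : MDifferentiableAt 𝓘(ℝ, E) 𝓘(ℝ, W₂) g p)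
    (v : TangentSpace 𝓘(ℝ, E) p) :
    mvfderiv 𝓘(ℝ, E) (fun q => B (f q) (g q)) p v =
      B (mvfderiv 𝓘(ℝ, E) f p v) (g p) + B (f p) (mvfderiv 𝓘(ℝ, E) g p v) := by
  have hc : ContinuousAt (fun q => B (f q) (g q)) p :=
    (B.continuous.continuousAt.comp hf.continuousAt).clm_apply hg.continuousAt
  have h : HasMFDerivAt 𝓘(ℝ, E) 𝓘(ℝ, W) (fun q => B (f q) (g q)) p _ :=
    ⟨hc, B.hasFDerivWithinAt_of_bilinear (hasMFDerivAt_mvfderiv hf).2 (hasMFDerivAt_mvfderiv hg).2⟩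
  refine (DFunLike.congr_fun h.mfderiv v).trans ?_
  -- The derivative is taken in a chart, so the undifferentiated factors are evaluated at `p` sent
  -- through the chart and back.
  rw [add_comm, extChartAt_to_inv]
  rfl

theorem mdifferentiableAt_mvfderiv_apply [IsManifold 𝓘(ℝ, E) 1 M] {f : M → W}
    {Y : ∀ q : M, TangentSpace 𝓘(ℝ, E) q} {p : M}
    (hf : ContMDiffAt 𝓘(ℝ, E) 𝓘(ℝ, W) 2 f p)
    (hY : MDifferentiableAt 𝓘(ℝ, E) 𝓘(ℝ, E).tangent
      (fun q => (⟨q, Y q⟩ : TangentBundle 𝓘(ℝ, E) M)) p) :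
    MDifferentiableAt 𝓘(ℝ, E) 𝓘(ℝ, W) (fun q => mvfderiv 𝓘(ℝ, E) f q (Y q)) p := by
  have h := hf.mfderiv_const (m := 1) (by norm_num)
  have := MDifferentiableAt.clm_apply_of_inCoordinates (h.mdifferentiableAt one_ne_zero) hY
    (hf.mdifferentiableAt two_ne_zero)
  exact (contMDiff_snd_tangentBundle_modelSpace W 𝓘(ℝ, W)).contMDiffAt.mdifferentiableAt one_ne_zero
    |>.comp p this

theorem contMDiffAt_mvfderiv_apply [IsManifold 𝓘(ℝ, E) 1 M] {f : M → W}
    {Y : ∀ q : M, TangentSpace 𝓘(ℝ, E) q} {p : M}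
    (hf : ContMDiffAt 𝓘(ℝ, E) 𝓘(ℝ, W) ∞ f p)
    (hY : ContMDiffAt 𝓘(ℝ, E) 𝓘(ℝ, E).tangent ∞
      (fun q => (⟨q, Y q⟩ : TangentBundle 𝓘(ℝ, E) M)) p) :
    ContMDiffAt 𝓘(ℝ, E) 𝓘(ℝ, W) ∞ (fun q => mvfderiv 𝓘(ℝ, E) f q (Y q)) p := by
  have h := hf.mfderiv_const (m := ∞) (by norm_num)
  have := ContMDiffAt.clm_apply_of_inCoordinates h hY hf
  exact (contMDiff_snd_tangentBundle_modelSpace W 𝓘(ℝ, W)).contMDiffAt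
    |>.comp p this

/-- Only the source needs trivializing; the differential then takes values in a fixed normed space,
where operator calculus applies. -/
theorem contMDiffAt_mvfderiv_comp_symmL [IsManifold 𝓘(ℝ, E) 1 M] {f : M → W} {p : M}
    (hf : ContMDiffAt 𝓘(ℝ, E) 𝓘(ℝ, W) ∞ f p) :
    ContMDiffAt 𝓘(ℝ, E) 𝓘(ℝ, E →L[ℝ] W) ∞ (fun q => mvfderiv 𝓘(ℝ, E) f q ∘L
      (trivializationAt E (TangentSpace 𝓘(ℝ, E)) p).symmL ℝ q) p := by
  refine (hf.mfderiv_const (m := ∞) (by norm_num)).congr_of_eventuallyEq (.of_forall fun q => ?_)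
  ext v
  simp [inTangentCoordinates, ContinuousLinearMap.inCoordinates]
  rfl

/-- In the chart at `p` this is the symmetry of the second derivative of `f`. -/
theorem mvfderiv_mlieBracket [IsManifold 𝓘(ℝ, E) 2 M] [CompleteSpace E] {f : M → W}
    {X Y : ∀ q : M, TangentSpace 𝓘(ℝ, E) q} {p : M}
    (hf : ContMDiffAt 𝓘(ℝ, E) 𝓘(ℝ, W) 2 f p)
    (hX : MDifferentiableAt 𝓘(ℝ, E) 𝓘(ℝ, E).tangent
      (fun q => (⟨q, X q⟩ : TangentBundle 𝓘(ℝ, E) M)) p)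
    (hY : MDifferentiableAt 𝓘(ℝ, E) 𝓘(ℝ, E).tangent
      (fun q => (⟨q, Y q⟩ : TangentBundle 𝓘(ℝ, E) M)) p) :
    mvfderiv 𝓘(ℝ, E) f p (VectorField.mlieBracket 𝓘(ℝ, E) X Y p) =
      mvfderiv 𝓘(ℝ, E) (fun q => mvfderiv 𝓘(ℝ, E) f q (Y q)) p (X p) -
      mvfderiv 𝓘(ℝ, E) (fun q => mvfderiv 𝓘(ℝ, E) f q (X q)) p (Y p) := by
  set φ := extChartAt 𝓘(ℝ, E) p
  set x := φ p
  have hxt : x ∈ φ.target := mem_extChartAt_target p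
  have hpx : φ.symm x = p := extChartAt_to_inv p
  let R : (∀ q : M, TangentSpace 𝓘(ℝ, E) q) → E → E := fun Z =>
    VectorField.mpullbackWithin 𝓘(ℝ, E) 𝓘(ℝ, E) φ.symm Z (Set.range 𝓘(ℝ, E))
  -- `R Z` is `Z` transported to the chart, so the chain rule cancels the derivative of `φ.symm`
  -- against its inverse.
  have key : ∀ {g : M → W} {Z : ∀ q : M, TangentSpace 𝓘(ℝ, E) q} {y : E}, y ∈ φ.target →
      MDifferentiableAt 𝓘(ℝ, E) 𝓘(ℝ, W) g (φ.symm y) →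
      fderiv ℝ (g ∘ φ.symm) y (R Z y) = mvfderiv 𝓘(ℝ, E) g (φ.symm y) (Z (φ.symm y)) := by
    intro g Z y hy hg
    have hi := isInvertible_mfderivWithin_extChartAt_symm (I := 𝓘(ℝ, E)) hy
    have hd := mdifferentiableWithinAt_extChartAt_symm (I := 𝓘(ℝ, E)) hy
    rw [ModelWithCorners.range_eq_univ, mdifferentiableWithinAt_univ] at hd
    have h0 : HasMFDerivAt 𝓘(ℝ, E) 𝓘(ℝ, W) (g ∘ φ.symm) y _ :=
      (hasMFDerivAt_mvfderiv hg).comp y hd.hasMFDerivAt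
    have hc : fderiv ℝ (g ∘ φ.symm) y = _ := mfderiv_eq_fderiv.symm.trans h0.mfderiv
    refine (DFunLike.congr_fun hc _).trans ?_
    have hRZ : R Z y = (mfderivWithin 𝓘(ℝ, E) 𝓘(ℝ, E) φ.symm (Set.range 𝓘(ℝ, E)) y).inverse
      (Z (φ.symm y)) := rfl
    rw [hRZ, ← mfderivWithin_univ, ← ModelWithCorners.range_eq_univ 𝓘(ℝ, E)]
    exact congrArg (mvfderiv 𝓘(ℝ, E) g (φ.symm y)) (hi.self_apply_inverse _)
  have hev : ∀ {Z : ∀ q : M, TangentSpace 𝓘(ℝ, E) q},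
      (fun q => mvfderiv 𝓘(ℝ, E) f q (Z q)) ∘ φ.symm =ᶠ[𝓝 x] fun y =>
      fderiv ℝ (f ∘ φ.symm) y (R Z y) := by
    intro Z
    have hd : ∀ᶠ q in 𝓝 p, MDifferentiableAt 𝓘(ℝ, E) 𝓘(ℝ, W) f q :=
      (contMDiffAt_iff_contMDiffAt_nhds (by simp)).1 hf |>.mono fun q hq =>
        hq.mdifferentiableAt two_ne_zero
    filter_upwards [extChartAt_target_mem_nhds p,
      (continuousAt_extChartAt_symm (I := 𝓘(ℝ, E)) p).eventually (hpx.symm ▸ hd)] with y hy hy'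
    exact (key hy hy').symm
  have hfx : ContDiffAt ℝ 2 (f ∘ φ.symm) x := by
    have := (contMDiffAt_iff.1 hf).2
    rwa [ModelWithCorners.range_eq_univ, contDiffWithinAt_univ] at this
  have hdiff : ∀ {Z : ∀ q : M, TangentSpace 𝓘(ℝ, E) q}, MDifferentiableAt 𝓘(ℝ, E) 𝓘(ℝ, E).tangent
      (fun q => (⟨q, Z q⟩ : TangentBundle 𝓘(ℝ, E) M)) p → DifferentiableAt ℝ (R Z) x := by
    intro Z hZ
    have : DifferentiableWithinAt ℝ (R Z) (φ.symm ⁻¹' Set.univ ∩ Set.range 𝓘(ℝ, E)) x :=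
      MDifferentiableWithinAt.differentiableWithinAt_mpullbackWithin_vectorField
        (mdifferentiableWithinAt_univ.2 hZ)
    rwa [Set.preimage_univ, Set.univ_inter, ModelWithCorners.range_eq_univ,
      differentiableWithinAt_univ] at this
  have hL := VectorField.fderiv_apply_lieBracket (n := 2) hfx (by simp) (hdiff hY) (hdiff hX)
  -- The tangent space at `p` is identified with `E` by this very chart, so the final pullback of
  -- the bracket is trivial.
  let T : E →L[ℝ] E := mfderiv 𝓘(ℝ, E) 𝓘(ℝ, E) φ p
  have hid : T = ContinuousLinearMap.id ℝ E := mfderiv_extChartAt_self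
  have hbr : VectorField.mlieBracket 𝓘(ℝ, E) X Y p =
      T.inverse (VectorField.lieBracketWithin ℝ (R X) (R Y)
        (φ.symm ⁻¹' Set.univ ∩ Set.range 𝓘(ℝ, E)) x) := rfl
  rw [hid, Set.preimage_univ, Set.univ_inter, ModelWithCorners.range_eq_univ,
    VectorField.lieBracketWithin_univ, ContinuousLinearMap.inverse_id] at hbr
  have hfp : fderiv ℝ (f ∘ φ.symm) x = mvfderiv 𝓘(ℝ, E) f p := by
    rw [(hf.mdifferentiableAt two_ne_zero).mvfderiv, ModelWithCorners.range_eq_univ,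
      fderivWithin_univ]
    rfl
  have hdp : ∀ {Z : ∀ q : M, TangentSpace 𝓘(ℝ, E) q}, MDifferentiableAt 𝓘(ℝ, E) 𝓘(ℝ, E).tangent
      (fun q => (⟨q, Z q⟩ : TangentBundle 𝓘(ℝ, E) M)) p →
      MDifferentiableAt 𝓘(ℝ, E) 𝓘(ℝ, W) (fun q => mvfderiv 𝓘(ℝ, E) f q (Z q)) (φ.symm x) :=
    fun hZ => hpx.symm ▸ mdifferentiableAt_mvfderiv_apply hf hZ
  rw [← hev.fderiv_eq, ← hev.fderiv_eq, key hxt (hdp hY), key hxt (hdp hX), hpx] at hL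
  rw [← hL, hbr, hfp]
  rfl

end Calculus


/-! ### The inverse function theorem on a manifold. -/

section InverseFunction

variable {E : Type*} [NormedAddCommGroup E] [NormedSpace ℝ E] [CompleteSpace E]
  {M : Type*} [TopologicalSpace M] [ChartedSpace E M] [IsManifold 𝓘(ℝ, E) ∞ M]
  {W : Type*} [NormedAddCommGroup W] [NormedSpace ℝ W]

/-- The inverse function theorem for a map from a manifold to a normed space whose derivative is
everywhere invertible. -/
theorem exists_partialDiffeomorph {f : M → W} (hf : ContMDiff 𝓘(ℝ, E) 𝓘(ℝ, W) ∞ f)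
    (hinv : ∀ q, (mvfderiv 𝓘(ℝ, E) f q).IsInvertible) (p : M) :
    ∃ e : PartialDiffeomorph 𝓘(ℝ, E) 𝓘(ℝ, W) M W ∞, p ∈ e.source ∧ Set.EqOn e f e.source := by
  set c := chartAt E p
  have hcd : ContMDiffOn 𝓘(ℝ, E) 𝓘(ℝ, E) ∞ c.symm c.target := contMDiffOn_chart_symm
  have hm : c.MDifferentiable 𝓘(ℝ, E) 𝓘(ℝ, E) :=
    haveI : IsManifold 𝓘(ℝ, E) 1 M := .of_le (n := ∞) (by simp)
    mdifferentiable_chart p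
  have hsmooth : ∀ y ∈ c.target, ContDiffAt ℝ ∞ (f ∘ c.symm) y := fun y hy =>
    contMDiffAt_iff_contDiffAt.1
      ((hf (c.symm y)).comp y ((hcd y hy).contMDiffAt (c.open_target.mem_nhds hy)))
  have hder : ∀ y ∈ c.target, ∃ T : E ≃L[ℝ] W, HasFDerivAt (f ∘ c.symm) (T : E →L[ℝ] W) y := by
    intro y hy
    have h0 : HasMFDerivAt 𝓘(ℝ, E) 𝓘(ℝ, W) (f ∘ c.symm) y _ :=
      (hasMFDerivAt_mvfderiv ((hf (c.symm y)).mdifferentiableAt (by simp))).comp y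
        (hm.mdifferentiableAt_symm hy).hasMFDerivAt
    obtain ⟨T, hT⟩ := hinv (c.symm y)
    let S : E ≃L[ℝ] W := (hm.symm.mfderiv hy).trans T
    refine ⟨S, ?_⟩
    have hS : mfderiv 𝓘(ℝ, E) 𝓘(ℝ, W) (f ∘ c.symm) y = (S : E →L[ℝ] W) := by
      rw [h0.mfderiv, ← hT]
      rfl
    have := ((hsmooth y hy).differentiableAt (by simp)).hasFDerivAt
    rwa [← mfderiv_eq_fderiv, hS] at this
  have hpc : c p ∈ c.target := mem_chart_target E p
  obtain ⟨T, hT⟩ := hder (c p) hpc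
  let g := (hsmooth (c p) hpc).toOpenPartialHomeomorph (f ∘ c.symm) hT (by simp)
  have hg : (g : E → W) = f ∘ c.symm := rfl
  have hpg : c p ∈ g.source := (hsmooth (c p) hpc).mem_toOpenPartialHomeomorph_source hT (by simp)
  let e := c.trans g
  have he : ∀ q ∈ e.source, e q = f q := by
    intro q hq
    have hqc : q ∈ c.source := (c.trans_source g ▸ hq).1
    simp [e, hg, hqc]
  refine ⟨{ toPartialEquiv := e.toPartialEquiv
            open_source := e.open_source
            open_target := e.open_target
            contMDiffOn_toFun := hf.contMDiffOn.congr he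
            contMDiffOn_invFun := ?_ }, ?_, he⟩
  · intro w hw
    have hw' : w ∈ e.target := hw
    rw [OpenPartialHomeomorph.trans_target] at hw'
    -- Smoothness of the inverse at `w` needs an invertible derivative at `g.symm w`, not only at `c
    -- p`.
    obtain ⟨S, hS⟩ := hder (g.symm w) hw'.2
    have h1 : ContDiffAt ℝ ∞ g.symm w := g.contDiffAt_symm hw'.1 hS (hsmooth _ hw'.2)
    have h2 := (hcd _ hw'.2).contMDiffAt (c.open_target.mem_nhds hw'.2)
    exact (h2.comp w h1.contMDiffAt).contMDiffWithinAt
  · change p ∈ e.source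
    rw [OpenPartialHomeomorph.trans_source]
    exact ⟨mem_chart_source E p, hpg⟩

end InverseFunction

/-! ### Smoothness of bundle maps built from differentials. -/

section Smooth

variable {E : Type*} [NormedAddCommGroup E] [NormedSpace ℝ E]
  {M : Type*} [TopologicalSpace M] [ChartedSpace E M] [IsManifold 𝓘(ℝ, E) 1 M]
  {W : Type*} [NormedAddCommGroup W] [NormedSpace ℝ W]

/-- Trivializing turns the field into `(df ∘ t⁻¹)⁻¹ ∘ (dg ∘ t⁻¹)`, and operator inversion is smooth
at invertible operators. With `g = df(Y)` it gives smoothness of `∇Y`. -/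
theorem contMDiffAt_inverse_comp_mvfderiv [CompleteSpace E] {f g : M → W} {p : M}
    (hf : ContMDiffAt 𝓘(ℝ, E) 𝓘(ℝ, W) ∞ f p) (hg : ContMDiffAt 𝓘(ℝ, E) 𝓘(ℝ, W) ∞ g p)
    (hinv : (mvfderiv 𝓘(ℝ, E) f p).IsInvertible) :
    ContMDiffAt 𝓘(ℝ, E) (𝓘(ℝ, E).prod 𝓘(ℝ, E →L[ℝ] E)) ∞
      (fun q => Bundle.TotalSpace.mk' (E →L[ℝ] E)
        (E := fun q : M => TangentSpace 𝓘(ℝ, E) q →L[ℝ] TangentSpace 𝓘(ℝ, E) q) q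
        ((mvfderiv 𝓘(ℝ, E) f q).inverse ∘L mvfderiv 𝓘(ℝ, E) g q)) p := by
  rw [contMDiffAt_hom_bundle]
  refine ⟨contMDiffAt_id, ?_⟩
  have hB := contMDiffAt_mvfderiv_comp_symmL hf
  have hC := contMDiffAt_mvfderiv_comp_symmL hg
  set t := trivializationAt E (TangentSpace 𝓘(ℝ, E) : M → Type _) p
  have hmem : p ∈ t.baseSet := FiberBundle.mem_baseSet_trivializationAt' p
  have hsymm : ∀ q (hq : q ∈ t.baseSet), t.symmL ℝ q =
      ((t.continuousLinearEquivAt ℝ q hq).symm : E →L[ℝ] TangentSpace 𝓘(ℝ, E) q) :=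
    fun q hq => (t.symm_continuousLinearEquivAt_eq' hq).symm
  have hI := ContMDiffAt.comp p (ContDiffAt.contMDiffAt (n := ∞)
    (ContinuousLinearMap.IsInvertible.contDiffAt_map_inverse (𝕜 := ℝ)
      (by rw [hsymm p hmem]; exact hinv.comp ContinuousLinearMap.isInvertible_equiv))) hB
  refine (hI.clm_comp hC).congr_of_eventuallyEq ?_
  filter_upwards [t.open_baseSet.mem_nhds hmem] with q hq
  rw [ContinuousLinearMap.inCoordinates_eq hq hq]
  simp only [Function.comp_def]
  rw [hsymm q hq, ContinuousLinearMap.inverse_comp_equiv]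
  rfl

theorem contMDiffAt_of_eq_bilin_mvfderiv (B : W →L[ℝ] W →L[ℝ] ℝ) {f : M → W} {p : M}
    (hf : ContMDiffAt 𝓘(ℝ, E) 𝓘(ℝ, W) ∞ f p)
    (β : (q : M) → TangentSpace 𝓘(ℝ, E) q →L[ℝ] TangentSpace 𝓘(ℝ, E) q →L[ℝ] ℝ)
    (hβ : ∀ q u v, β q u v = B (mvfderiv 𝓘(ℝ, E) f q u) (mvfderiv 𝓘(ℝ, E) f q v)) :
    ContMDiffAt 𝓘(ℝ, E) (𝓘(ℝ, E).prod 𝓘(ℝ, E →L[ℝ] E →L[ℝ] ℝ)) ∞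
      (fun q => Bundle.TotalSpace.mk' (E →L[ℝ] E →L[ℝ] ℝ)
      (E := fun p : M => TangentSpace 𝓘(ℝ, E) p →L[ℝ] TangentSpace 𝓘(ℝ, E) p →L[ℝ] ℝ) q (β q)) p := by
  rw [contMDiffAt_hom_bundle]
  refine ⟨contMDiffAt_id, ?_⟩
  have hC := contMDiffAt_mvfderiv_comp_symmL hf
  have h1 := (contMDiffAt_const (c := B)).clm_comp hC
  have h2 := hC.clm_precomp (F₃ := ℝ)
  refine (h2.clm_comp h1).congr_of_eventuallyEq ?_
  filter_upwards [(trivializationAt E (TangentSpace 𝓘(ℝ, E) : M → Type _) p).open_baseSet.mem_nhds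
    (FiberBundle.mem_baseSet_trivializationAt' p)] with q hq
  ext u v
  rw [inCoordinates_apply_eq₂ hq hq (by simp)]
  simp [hβ, ← Bundle.Trivialization.symmL_apply (R := ℝ) _ hq]

end Smooth


/-! ### The pulled-back flat connection and constant form. -/

section PullbackConnection

variable {E : Type*} [NormedAddCommGroup E] [NormedSpace ℂ E]
  {M : Type*} [TopologicalSpace M] [ChartedSpace E M] [IsManifold 𝓘(ℂ, E) ω M]
  {W W' : Type*} [NormedAddCommGroup W] [NormedSpace ℝ W]
  [NormedAddCommGroup W'] [NormedSpace ℝ W']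

/-- The pullback of the trivial connection of a vector space `W` along a smooth map `f : M → W`
with everywhere invertible derivative. -/
noncomputable def pullbackConnection (f : M → W) (hf : ContMDiff 𝓘(ℝ, E) 𝓘(ℝ, W) ∞ f)
    (hinv : ∀ q, (mvfderiv 𝓘(ℝ, E) f q).IsInvertible) : Connection E M where
  toFun Y p := (mvfderiv 𝓘(ℝ, E) f p).inverse ∘L
    mvfderiv 𝓘(ℝ, E) (fun q => mvfderiv 𝓘(ℝ, E) f q (Y q)) p
  isCovariantDerivativeOnUniv :=
    { add := by
        intro σ σ' p hσ hσ' _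
        have h2 : ContMDiffAt 𝓘(ℝ, E) 𝓘(ℝ, W) 2 f p := (hf p).of_le ENat.LEInfty.out
        rw [← ContinuousLinearMap.comp_add, ← mvfderiv_fun_add
          (mdifferentiableAt_mvfderiv_apply h2 hσ) (mdifferentiableAt_mvfderiv_apply h2 hσ')]
        simp only [Pi.add_apply, map_add]
      leibniz := by
        intro σ g p hσ hg _
        have h2 : ContMDiffAt 𝓘(ℝ, E) 𝓘(ℝ, W) 2 f p := (hf p).of_le ENat.LEInfty.out
        have h := mvfderiv_fun_smul hg (mdifferentiableAt_mvfderiv_apply h2 hσ)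
        have h' : (fun q => mvfderiv 𝓘(ℝ, E) f q ((g • σ) q)) =
            fun q => g q • mvfderiv 𝓘(ℝ, E) f q (σ q) := funext fun q =>
            (mvfderiv 𝓘(ℝ, E) f q).map_smul (g q) (σ q)
        rw [h', h]
        ext v
        simp [(hinv p).inverse_apply_self] }

section

variable {f : M → W} (hf : ContMDiff 𝓘(ℝ, E) 𝓘(ℝ, W) ∞ f)
  (hinv : ∀ q, (mvfderiv 𝓘(ℝ, E) f q).IsInvertible)

/-- Applying `df` removes the inverse; later identities use the connection through this relation. -/
theorem mvfderiv_cov_pullbackConnection (X Y : VField E M) (p : M) :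
    mvfderiv 𝓘(ℝ, E) f p (Connection.cov (pullbackConnection f hf hinv) X Y p) =
      mvfderiv 𝓘(ℝ, E) (fun q => mvfderiv 𝓘(ℝ, E) f q (Y q)) p (X p) :=
  (hinv p).self_apply_inverse _

theorem SmoothAt.mdifferentiableAt {X : VField E M} {p : M} (hX : SmoothAt X p) :
    MDifferentiableAt 𝓘(ℝ, E) 𝓘(ℝ, E).tangent
      (fun q => (⟨q, X q⟩ : TangentBundle 𝓘(ℝ, E) M)) p :=
  ContMDiffAt.mdifferentiableAt hX (by simp)

/-- A constant `L` commutes with differentiation, so both sides of the affine condition equal `L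
(X(df Y))`. -/
theorem isAffineOn_pullbackConnection (L : W →L[ℝ] ℝ) {g : M → ℝ} {U : Set M} (hU : IsOpen U)
    (hg : ∀ q ∈ U, g q = L (f q)) : IsAffineOn (pullbackConnection f hf hinv) g U := by
  refine ⟨fun q hq => ((L.contMDiff.comp hf).contMDiffOn q hq).congr hg (hg q hq),
    fun p hp X Y hX hY => ?_⟩
  have hd : ∀ q ∈ U, mvfderiv 𝓘(ℝ, E) g q = L ∘L mvfderiv 𝓘(ℝ, E) f q := fun q hq => by
    rw [← mvfderiv_clm_comp L ((hf q).mdifferentiableAt (by simp))]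
    exact mvfderiv_congr_of_eventuallyEq (Filter.eventuallyEq_of_mem (hU.mem_nhds hq) hg)
  have hl : lieDeriv Y g =ᶠ[𝓝 p] fun q => L (mvfderiv 𝓘(ℝ, E) f q (Y q)) :=
    Filter.eventuallyEq_of_mem (hU.mem_nhds hp) fun q hq => by rw [lieDeriv, hd q hq]; rfl
  rw [lieDeriv, mvfderiv_congr_of_eventuallyEq hl, mvfderiv_clm_comp, hd p hp]
  · exact congrArg L (mvfderiv_cov_pullbackConnection hf hinv X Y p).symm
  · exact (contMDiffAt_mvfderiv_apply (hf p) hY).mdifferentiableAt (by simp)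

theorem isParallel_pullbackConnection (Ω : W →L[ℝ] W →L[ℝ] ℝ) {B : BilinField E M}
    (hB : ∀ q u v, B q u v = Ω (mvfderiv 𝓘(ℝ, E) f q u) (mvfderiv 𝓘(ℝ, E) f q v)) :
    IsParallel (pullbackConnection f hf hinv) B := by
  intro p X Y Z hX hY hZ
  simp only [lieDeriv, hB, mvfderiv_cov_pullbackConnection]
  exact mvfderiv_bilin Ω ((contMDiffAt_mvfderiv_apply (hf p) hY).mdifferentiableAt (by simp))
    ((contMDiffAt_mvfderiv_apply (hf p) hZ).mdifferentiableAt (by simp)) _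

variable [FiniteDimensional ℂ E]

theorem mvfderiv_mlieBracket_of_smoothAt {h : M → W'} {p : M} (hh : ContMDiffAt 𝓘(ℝ, E) 𝓘(ℝ, W') ∞ h p)
    {X Y : VField E M} (hX : SmoothAt X p) (hY : SmoothAt Y p) :
    mvfderiv 𝓘(ℝ, E) h p (VectorField.mlieBracket 𝓘(ℝ, E) X Y p) =
      mvfderiv 𝓘(ℝ, E) (fun q => mvfderiv 𝓘(ℝ, E) h q (Y q)) p (X p) -
      mvfderiv 𝓘(ℝ, E) (fun q => mvfderiv 𝓘(ℝ, E) h q (X q)) p (Y p) :=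
  have : CompleteSpace E := FiniteDimensional.complete ℂ E
  mvfderiv_mlieBracket (hh.of_le ENat.LEInfty.out) hX.mdifferentiableAt
    hY.mdifferentiableAt

theorem pullbackConnection_torsion {X Y : VField E M} {p : M}
    (hX : MDifferentiableAt 𝓘(ℝ, E) 𝓘(ℝ, E).tangent
      (fun q => (⟨q, X q⟩ : TangentBundle 𝓘(ℝ, E) M)) p)
    (hY : MDifferentiableAt 𝓘(ℝ, E) 𝓘(ℝ, E).tangent
      (fun q => (⟨q, Y q⟩ : TangentBundle 𝓘(ℝ, E) M)) p) :
    Connection.cov (pullbackConnection f hf hinv) X Y p -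
      Connection.cov (pullbackConnection f hf hinv) Y X p =
      VectorField.mlieBracket 𝓘(ℝ, E) X Y p := by
  have : CompleteSpace E := FiniteDimensional.complete ℂ E
  apply (hinv p).injective
  rw [map_sub, mvfderiv_cov_pullbackConnection, mvfderiv_cov_pullbackConnection,
    mvfderiv_mlieBracket ((hf p).of_le ENat.LEInfty.out) hX hY]

theorem isTorsionFree_pullbackConnection : IsTorsionFree (pullbackConnection f hf hinv) := by
  have : CompleteSpace E := FiniteDimensional.complete ℂ E
  exact (CovariantDerivative.torsion_eq_zero_iff _).2 fun hX hY =>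
    pullbackConnection_torsion hf hinv hX hY

/-- Under `df` the curvature becomes the defect in the bracket formula for the function `df(Z)`. -/
theorem isFlat_pullbackConnection : IsFlat (pullbackConnection f hf hinv) := by
  intro p X Y Z hX hY hZ
  apply (hinv p).injective
  have h := mvfderiv_mlieBracket_of_smoothAt (contMDiffAt_mvfderiv_apply (hf p) hZ) hX hY
  simp only [map_sub, mvfderiv_cov_pullbackConnection, map_zero, h, sub_self]

theorem contMDiff_pullbackConnection :
    CovariantDerivative.ContMDiffCovariantDerivative (pullbackConnection f hf hinv) ∞ := by
  have : CompleteSpace E := FiniteDimensional.complete ℂ E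
  refine ⟨⟨fun {σ} hσ p hp => ?_⟩⟩
  have hσp := (hσ p hp).contMDiffAt Filter.univ_mem
  exact (contMDiffAt_inverse_comp_mvfderiv (hf p) (contMDiffAt_mvfderiv_apply (hf p) hσp)
    (hinv p)).contMDiffWithinAt

/-- If `df ∘ A` is the differential of a map `g`, then `d^∇ A = 0`. -/
theorem covEnd_pullbackConnection_symm
    {A : (p : M) → TangentSpace 𝓘(ℝ, E) p →L[ℝ] TangentSpace 𝓘(ℝ, E) p} {g : M → W}
    (hg : ContMDiff 𝓘(ℝ, E) 𝓘(ℝ, W) ∞ g)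
    (hA : ∀ q u, mvfderiv 𝓘(ℝ, E) f q (A q u) = mvfderiv 𝓘(ℝ, E) g q u) {p : M}
    {X Y : VField E M} (hX : SmoothAt X p) (hY : SmoothAt Y p) :
    covEnd (pullbackConnection f hf hinv) A X Y p -
      covEnd (pullbackConnection f hf hinv) A Y X p = 0 := by
  apply (hinv p).injective
  have h := mvfderiv_mlieBracket_of_smoothAt (hg p) hX hY
  -- With the bracket written as `∇_X Y - ∇_Y X`, the formula for `g` matches the terms `A(∇_X Y)`
  -- and `A(∇_Y X)`.
  rw [← pullbackConnection_torsion hf hinv hX.mdifferentiableAt hY.mdifferentiableAt, map_sub] at h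
  simp only [covEnd, map_sub, mvfderiv_cov_pullbackConnection, hA, map_zero]
  rw [sub_sub_sub_comm, h, sub_self]

end

theorem isSymplecticForm_of_eq [FiniteDimensional ℂ E] {f : M → W} (hf : ContMDiff 𝓘(ℝ, E) 𝓘(ℝ, W) ∞ f)
    (hinv : ∀ q, (mvfderiv 𝓘(ℝ, E) f q).IsInvertible) (Ω : W →L[ℝ] W →L[ℝ] ℝ) {B : BilinField E M}
    (hB : ∀ q u v, B q u v = Ω (mvfderiv 𝓘(ℝ, E) f q u) (mvfderiv 𝓘(ℝ, E) f q v))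
    (halt : ∀ w, Ω w w = 0) (hnd : ∀ w, (∀ w', Ω w w' = 0) → w = 0) :
    IsSymplecticForm B where
  smooth p := contMDiffAt_of_eq_bilin_mvfderiv Ω (hf p) B hB
  alternating p u := by rw [hB, halt]
  nondegenerate p u hu := by
    apply (hinv p).injective
    rw [map_zero]
    refine hnd _ fun w' => ?_
    have := hu ((mvfderiv 𝓘(ℝ, E) f p).inverse w')
    rwa [hB, (hinv p).self_apply_inverse] at this
  closed p X Y Z hX hY hZ := by
    have hpar := isParallel_pullbackConnection hf hinv Ω hB
    have hskew : ∀ u v, B p u v = - B p v u := fun u v => by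
      have h := halt (mvfderiv 𝓘(ℝ, E) f p u + mvfderiv 𝓘(ℝ, E) f p v)
      simp only [map_add, add_apply, halt, ← hB] at h
      linarith
    -- Parallelism yields six terms from the derivatives, vanishing torsion six from the brackets;
    -- they cancel by skew-symmetry.
    rw [hpar p X Y Z hX hY hZ, hpar p Y X Z hY hX hZ, hpar p Z X Y hZ hX hY,
      ← pullbackConnection_torsion hf hinv hX.mdifferentiableAt hY.mdifferentiableAt,
      ← pullbackConnection_torsion hf hinv hX.mdifferentiableAt hZ.mdifferentiableAt,
      ← pullbackConnection_torsion hf hinv hY.mdifferentiableAt hZ.mdifferentiableAt]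
    simp only [map_sub, sub_apply]
    rw [hskew (Y p), hskew (X p), hskew (X p)]
    ring

end PullbackConnection


/-! ### Holomorphic maps seen as real maps. -/

section RestrictScalars

variable {E : Type*} [NormedAddCommGroup E] [NormedSpace ℂ E]
  {M : Type*} [TopologicalSpace M] [ChartedSpace E M]
  {V : Type*} [NormedAddCommGroup V] [NormedSpace ℂ V]

theorem contMDiff_real_of_complex {f : M → V} {k : WithTop ℕ∞} (hf : ContMDiff 𝓘(ℂ, E) 𝓘(ℂ, V) k f) :
    ContMDiff 𝓘(ℝ, E) 𝓘(ℝ, V) k f := fun p =>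
  contMDiffAt_iff.2 ⟨(hf p).continuousAt, (contMDiffAt_iff.1 (hf p)).2.restrict_scalars ℝ⟩

theorem mvfderiv_real_apply {f : M → V} {p : M} (hf : MDifferentiableAt 𝓘(ℂ, E) 𝓘(ℂ, V) f p)
    (u : TangentSpace 𝓘(ℝ, E) p) :
    mvfderiv 𝓘(ℝ, E) f p u = mvfderiv 𝓘(ℂ, E) f p (u : E) := by
  have h : HasMFDerivAt 𝓘(ℝ, E) 𝓘(ℝ, V) f p _ :=
    ⟨hf.continuousAt, hf.hasMFDerivAt.2.restrictScalars ℝ⟩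
  exact DFunLike.congr_fun h.mfderiv u

/-- The real differential of a holomorphic map is its complex differential with scalars restricted,
hence `ℂ`-linear. -/
theorem mvfderiv_complexStructure {f : M → V} {p : M}
    (hf : MDifferentiableAt 𝓘(ℂ, E) 𝓘(ℂ, V) f p) (u : TangentSpace 𝓘(ℝ, E) p) :
    mvfderiv 𝓘(ℝ, E) f p (complexStructure p u) = Complex.I • mvfderiv 𝓘(ℝ, E) f p u := by
  rw [mvfderiv_real_apply hf, mvfderiv_real_apply hf]
  exact (mvfderiv 𝓘(ℂ, E) f p).map_smul Complex.I (u : E)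

end RestrictScalars

/-! ### Linear algebra of `V` and `V^τ`. -/

section Ambient

variable {n : ℕ}

/-- The projection `V → V^τ`, `v ↦ Re v`, in the coordinates `(x, y)`. -/
noncomputable def reProj (n : ℕ) : CotangentCn n →L[ℝ] (Fin n → ℝ) × (Fin n → ℝ) :=
  (ContinuousLinearMap.pi dx).prod (ContinuousLinearMap.pi dy)

/-- The form `2 ∑ dxⁱ ∧ dyᵢ` on `ℝⁿ × ℝⁿ`. -/
noncomputable def stdForm (n : ℕ) :
    ((Fin n → ℝ) × (Fin n → ℝ)) →L[ℝ] ((Fin n → ℝ) × (Fin n → ℝ)) →L[ℝ] ℝ :=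
  (2 : ℝ) • ∑ i : Fin n,
    wedge (ContinuousLinearMap.proj i ∘L ContinuousLinearMap.fst ℝ (Fin n → ℝ) (Fin n → ℝ))
      (ContinuousLinearMap.proj i ∘L ContinuousLinearMap.snd ℝ (Fin n → ℝ) (Fin n → ℝ))

theorem stdForm_apply (a b : (Fin n → ℝ) × (Fin n → ℝ)) :
    stdForm n a b = 2 * ∑ i, (a.1 i * b.2 i - a.2 i * b.1 i) := by
  simp only [stdForm, wedge, smul_apply, sum_apply, sub_apply,
    ContinuousLinearMap.smulRight_apply, ContinuousLinearMap.comp_apply]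
  rfl

theorem stdForm_self (a : (Fin n → ℝ) × (Fin n → ℝ)) : stdForm n a a = 0 := by
  simp [stdForm_apply, mul_comm]

theorem stdForm_nondegenerate (a : (Fin n → ℝ) × (Fin n → ℝ)) (h : ∀ b, stdForm n a b = 0) :
    a = 0 := by
  ext i
  · simpa [stdForm_apply, Pi.single_apply] using h (0, Pi.single i 1)
  · simpa [stdForm_apply, Pi.single_apply] using h (Pi.single i 1, 0)

theorem I_smul_mem_realForm {v : CotangentCn n} (h : reProj n v = 0) :
    Complex.I • v ∈ realForm n := by
  change star (Complex.I • v) = Complex.I • v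
  have h1 : ∀ i, (v.1 i).re = 0 := fun i => congrFun (congrArg Prod.fst h) i
  have h2 : ∀ i, (v.2 i).re = 0 := fun i => congrFun (congrArg Prod.snd h) i
  ext i <;> simp [Complex.ext_iff, h1, h2]

end Ambient

/-! ### Invertibility of `d(Re φ)`. -/

section Immersion

variable {E : Type*} [NormedAddCommGroup E] [NormedSpace ℂ E]
  {M : Type*} [TopologicalSpace M] [ChartedSpace E M] {n : ℕ} {φ : M → CotangentCn n}

namespace IsHolomorphicImmersion

variable (hφ : IsHolomorphicImmersion (E := E) φ)
include hφ

theorem mdifferentiableAt (p : M) : MDifferentiableAt 𝓘(ℂ, E) 𝓘(ℂ, CotangentCn n) φ p :=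
  (hφ.holomorphic p).mdifferentiableAt (by simp)

theorem contMDiff_real : ContMDiff 𝓘(ℝ, E) 𝓘(ℝ, CotangentCn n) ∞ φ :=
  (contMDiff_real_of_complex hφ.holomorphic).of_le (by simp)

theorem contMDiff_clm_comp {W : Type*} [NormedAddCommGroup W] [NormedSpace ℝ W]
    (L : CotangentCn n →L[ℝ] W) : ContMDiff 𝓘(ℝ, E) 𝓘(ℝ, W) ∞ (fun q => L (φ q)) :=
  L.contMDiff.comp hφ.contMDiff_real

theorem mvfderiv_clm_comp_apply {W : Type*} [NormedAddCommGroup W] [NormedSpace ℝ W]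
    (L : CotangentCn n →L[ℝ] W) (p : M) (u : TangentSpace 𝓘(ℝ, E) p) :
    mvfderiv 𝓘(ℝ, E) (fun q => L (φ q)) p u = L (mvfderiv 𝓘(ℝ, E) φ p u) := by
  rw [mvfderiv_clm_comp L ((hφ.contMDiff_real p).mdifferentiableAt (by simp))]
  rfl

theorem contMDiff_realPart : ContMDiff 𝓘(ℝ, E) 𝓘(ℝ, (Fin n → ℝ) × (Fin n → ℝ)) ∞ (realPart φ) :=
  hφ.contMDiff_clm_comp (reProj n)

theorem mvfderiv_realPart_apply (p : M) (u : TangentSpace 𝓘(ℝ, E) p) :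
    mvfderiv 𝓘(ℝ, E) (realPart φ) p u = reProj n (mvfderiv 𝓘(ℝ, E) φ p u) :=
  hφ.mvfderiv_clm_comp_apply (reProj n) p u

theorem inducedForm_apply (p : M) (u v : TangentSpace 𝓘(ℝ, E) p) :
    inducedForm φ p u v =
      stdForm n (mvfderiv 𝓘(ℝ, E) (realPart φ) p u) (mvfderiv 𝓘(ℝ, E) (realPart φ) p v) := by
  rw [stdForm_apply, hφ.mvfderiv_realPart_apply, hφ.mvfderiv_realPart_apply]
  simp [inducedForm, wedge, reProj]

/-- The kernel consists of vectors with imaginary image; multiplying by `i` moves that image into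
`V^τ` and keeps it in the complex subspace `dφ(T_p M)`. -/
theorem injective_mvfderiv_realPart (hτ : IsTotallyComplex (E := E) φ) (p : M) :
    Function.Injective (mvfderiv 𝓘(ℝ, E) (realPart φ) p) := by
  rw [injective_iff_map_eq_zero]
  intro u hu
  rw [hφ.mvfderiv_realPart_apply] at hu
  have h1 : Complex.I • mvfderiv 𝓘(ℝ, E) φ p u ∈
      (realForm n : Set (CotangentCn n)) ∩ Set.range (mvfderiv 𝓘(ℂ, E) φ p) := by
    refine ⟨I_smul_mem_realForm hu, complexStructure p u, ?_⟩
    rw [← mvfderiv_complexStructure (hφ.mdifferentiableAt p),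
      mvfderiv_real_apply (hφ.mdifferentiableAt p)]
  rw [hτ p, Set.mem_singleton_iff, smul_eq_zero_iff_right Complex.I_ne_zero,
    mvfderiv_real_apply (hφ.mdifferentiableAt p)] at h1
  exact hφ.injective_deriv p (h1.trans (map_zero _).symm)

theorem isInvertible_mvfderiv_realPart [FiniteDimensional ℂ E] (hn : Module.finrank ℂ E = n)
    (hτ : IsTotallyComplex (E := E) φ) (p : M) :
    (mvfderiv 𝓘(ℝ, E) (realPart φ) p).IsInvertible := by
  have : FiniteDimensional ℝ E := FiniteDimensional.complexToReal E
  let T : E →L[ℝ] (Fin n → ℝ) × (Fin n → ℝ) := mvfderiv 𝓘(ℝ, E) (realPart φ) p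
  have hT : Function.Injective T := hφ.injective_mvfderiv_realPart hτ p
  have hrank : Module.finrank ℝ E = Module.finrank ℝ ((Fin n → ℝ) × (Fin n → ℝ)) := by
    rw [finrank_real_of_complex, hn]
    simp [two_mul]
  refine ⟨(LinearEquiv.ofInjectiveOfFinrankEq (T : E →ₗ[ℝ] _) hT hrank).toContinuousLinearEquiv, ?_⟩
  ext u <;> rfl

end IsHolomorphicImmersion

end Immersion

end SpecialGeometry

/-! ### Assembly of the theorem. -/

open SpecialGeometry in
theorem theorem2 {n : ℕ}
    {E : Type*} [NormedAddCommGroup E] [NormedSpace ℂ E] [FiniteDimensional ℂ E]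
    (hn : Module.finrank ℂ E = n)
    {M : Type*} [TopologicalSpace M] [T2Space M] [ChartedSpace E M] [IsManifold 𝓘(ℂ, E) ω M]
    (φ : M → SpecialGeometry.CotangentCn n)
    (hφ : SpecialGeometry.IsHolomorphicImmersion (E := E) φ)
    (hτ : SpecialGeometry.IsTotallyComplex (E := E) φ) :
    ∃ D : SpecialGeometry.Connection E M,
      D.toFun = SpecialGeometry.inducedConnection φ ∧
      SpecialGeometry.IsSpecialSymplectic D (SpecialGeometry.inducedForm φ) ∧
      ∀ p : M, ∃ e : SpecialGeometry.LocalCoordinates E M n,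
        p ∈ e.source ∧ Set.EqOn e (SpecialGeometry.realPart φ) e.source ∧
        SpecialGeometry.IsRealSpecialCoordinates D (SpecialGeometry.inducedForm φ) e := by
  have hf := hφ.contMDiff_realPart
  have hinv := hφ.isInvertible_mvfderiv_realPart hn hτ
  refine ⟨pullbackConnection (realPart φ) hf hinv, rfl, ⟨⟨contMDiff_pullbackConnection hf hinv,
    isFlat_pullbackConnection hf hinv, isTorsionFree_pullbackConnection hf hinv, ?_⟩,
    isSymplecticForm_of_eq hf hinv (stdForm n) hφ.inducedForm_apply stdForm_self
      stdForm_nondegenerate,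
    isParallel_pullbackConnection hf hinv (stdForm n) hφ.inducedForm_apply⟩, fun p => ?_⟩
  · intro p X Y hX hY
    -- `L ∘ φ = Re(iφ) = -Im φ`, whose differential is `d(Re φ) ∘ J`.
    let L : CotangentCn n →L[ℝ] (Fin n → ℝ) × (Fin n → ℝ) :=
      reProj n ∘L (Complex.I • ContinuousLinearMap.id ℝ (CotangentCn n))
    refine covEnd_pullbackConnection_symm hf hinv (hφ.contMDiff_clm_comp L) (fun q u => ?_) hX hY
    rw [hφ.mvfderiv_realPart_apply, mvfderiv_complexStructure (hφ.mdifferentiableAt q),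
      hφ.mvfderiv_clm_comp_apply]
    rfl
  · have : CompleteSpace E := FiniteDimensional.complete ℂ E
    obtain ⟨e, hp, he⟩ := exists_partialDiffeomorph hf hinv p
    have he' : Set.EqOn e (realPart φ) e.source := he
    refine ⟨e, hp, he', ⟨fun i => ?_, fun i => ?_, fun q hq => ?_⟩⟩
    · exact isAffineOn_pullbackConnection hf hinv
        (ContinuousLinearMap.proj i ∘L ContinuousLinearMap.fst ℝ _ _) e.open_source
        fun q hq => by rw [he' hq]; rfl
    · exact isAffineOn_pullbackConnection hf hinv
        (ContinuousLinearMap.proj i ∘L ContinuousLinearMap.snd ℝ _ _) e.open_source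
        fun q hq => by rw [he' hq]; rfl
    -- `e` is known to equal `Re φ` only on its open source, which suffices for equal differentials
    -- there.
    · have hev : e =ᶠ[𝓝 q] realPart φ := Filter.eventuallyEq_of_mem (e.open_source.mem_nhds hq) he'
      have hx : ∀ i, mvfderiv 𝓘(ℝ, E) (fun q => (e q).1 i) q = dx i ∘L mvfderiv 𝓘(ℝ, E) φ q := by
        intro i
        rw [mvfderiv_congr_of_eventuallyEq (g := fun q => dx i (φ q))
          (hev.mono fun q h => by rw [h]; rfl)]
        ext u
        rw [hφ.mvfderiv_clm_comp_apply]
        rfl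
      have hy : ∀ i, mvfderiv 𝓘(ℝ, E) (fun q => (e q).2 i) q = dy i ∘L mvfderiv 𝓘(ℝ, E) φ q := by
        intro i
        rw [mvfderiv_congr_of_eventuallyEq (g := fun q => dy i (φ q))
          (hev.mono fun q h => by rw [h]; rfl)]
        ext u
        rw [hφ.mvfderiv_clm_comp_apply]
        rfl
      simp only [hx, hy]
      rfl
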